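/- **Theorem (Exponent for partly smooth KL functions).** Conventions. $\mathbb{R}^n$ carries the Euclidean inner product and norm. A function $f:\mathbb{R}^n\to[-\infty,\infty]$ is *proper* if it is never $-\infty$ and $\mathrm{dom}\,f=\{x: f(x)<\infty\}\neq\emptyset$, and *closed* if it is lower semicontinuous. For $x\in\mathrm{dom}\,f$, the regular subdifferential is $$\widehat\partial f(x)=\Big\{v:\ \liminf_{z\to x,\,z\ne x}\frac{f(z)-f(x)-\langle v,z-x\rangle}{\|z-x\|}\ge 0\Big\},$$ and the limiting subdifferential $\partial f(x)$ is the set of all limits $v=\lim_t v^t$ with $v^t\in\widehat\partial f(x^t)$, $x^t\to x$, $f(x^t)\to f(x)$; both are empty when $x\notin\mathrm{dom}\,f$. For a set $S$ and $x\in S$, with $\delta_S$ the indicator function ($0$ on $S$, $+\infty$ off $S$), $N_S(x)=\partial\delta_S(x)$ and $\widehat N_S(x)=\widehat\partial\delta_S(x)$ are the limiting and regular normal cones. A function $f$ is *regular* at $x\in\mathrm{dom}\,f$ if $N_{\mathrm{epi} f}=\widehat N_{\mathrm{epi} f}$ at $(x,f(x))$. The function $f$ is *prox-regular* at $\bar x\in\mathrm{dom}\,f$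 if for every $\bar v\in\partial f(\bar x)$ there are $\rho\ge 0$ and $\delta>0$ such that $f(x')\ge f(x)+\langle v,x'-x\rangle-\frac{\rho}{2}\|x'-x\|^2$ whenever $\|x-\bar x\|<\delta$, $\|x'-\bar x\|<\delta$, $|f(x)-f(\bar x)|<\delta$, $v\in\partial f(x)$ and $\|v-\bar v\|<\delta$. A set $\mathfrak M\ni\bar x$ is a *$C^2$ manifold about $\bar x$* if on some open neighbourhood of $\bar x$ it is the solution set of finitely many $C^2$ equations $g_i(x)=0$ whose gradients $\nabla g_i(\bar x)$ are linearly independent. $T_x(\mathfrak M)$ is its tangent space at $x$, and $P_{\mathfrak M}$ the nearest-point projection onto $\mathfrak M$, which is well defined near $\bar x$. For $x\in\mathfrak M$ near $\bar x$ and $f$ whose restriction to $\mathfrak M$ is $C^2$ near $x$, the covariant derivative $\nabla_{\mathfrak M}f(x)$ is the unique vector in $T_x(\mathfrak M)$ with $\langle\nabla_{\mathfrak M}f(x),\xi\rangle=\frac{d}{dt}f(P_{\mathfrak M}(x+t\xi))\big|_{t=0}$ for all $\xi\in T_x(\mathfrak M)$. The function $f$ is *$C^2$-partly smooth at $\bar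 x$ relative to $\mathfrak M$* if $\mathfrak M$ is a $C^2$ manifold about $\bar x$ and (i) the restriction of $f$ to $\mathfrak M$ is $C^2$ near $\bar x$ (it agrees on $\mathfrak M$, near $\bar x$, with a $C^2$ function defined on a neighbourhood of $\bar x$); (ii) at every $x\in\mathfrak M$ close to $\bar x$, $f$ is regular and $\partial f(x)\ne\emptyset$; (iii) the affine span of $\partial f(\bar x)$ is a translate of $N_{\mathfrak M}(\bar x)$; (iv) the set-valued map $\partial f$ restricted to $\mathfrak M$ is continuous (inner and outer semicontinuous in the sense of Painlevé–Kuratowski) at $\bar x$. Statement. Let $f:\mathbb{R}^n\to(-\infty,\infty]$ be proper and closed, prox-regular at $\bar x$ and $C^2$-partly smooth at $\bar x$ relative to $\mathfrak M$, and suppose that $0\in\mathrm{ri}\,\partial f(\bar x)$ (the relative interior). Suppose further that there exist $c,\nu,\epsilon>0$ and $\alpha\in[0,1)$ such that for every $x\in\mathfrak M$ with $\|x-\bar x\|\le\epsilon$ and $f(\bar x)<f(x)<f(\bar x)+\nu$, the covariant derivative $\nabla_{\mathfrak M}f(x)$ exists and $$\|\nabla_{\mathfrak M}f(x)\|\ge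 c\,(f(x)-f(\bar x))^{\alpha}.$$ Then $f$ has the Kurdyka–Łojasiewicz property at $\bar x$ with exponent $\alpha$: $\partial f(\bar x)\neq\emptyset$, and there exist $c',\epsilon'>0$ and $\nu'\in(0,\infty]$ such that $$\mathrm{dist}(0,\partial f(x))\ge c'\,(f(x)-f(\bar x))^{\alpha}\quad\text{whenever } \|x-\bar x\|\le\epsilon' \text{ and } f(\bar x)<f(x)<f(\bar x)+\nu',$$ where $\mathrm{dist}(0,\emptyset)=+\infty$. -/

import Mathlib

open Set Filter Topology
open scoped InnerProductSpace

namespace VarAnalysis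

noncomputable section

variable {E : Type*} [NormedAddCommGroup E] [InnerProductSpace ℝ E]

/-- An extended-real-valued function is proper if it never takes the value `-∞` and its domain
`{x | f x < ∞}` is nonempty. -/
def IsProper (f : E → EReal) : Prop :=
  (∀ x, f x ≠ ⊥) ∧ ∃ x, f x < ⊤

/-- The regular (Fréchet) subdifferential; it is empty outside the domain of `f`. -/
def regularSubdifferential (f : E → EReal) (x : E) : Set E :=
  {v | f x < ⊤ ∧
    0 ≤ liminf (fun z => (f z - f x - ((⟪v, z - x⟫_ℝ : ℝ) : EReal)) / ((‖z - x‖ : ℝ) : EReal))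
      (𝓝[≠] x)}

/-- The limiting subdifferential; it is empty outside the domain of `f`. -/
def subdifferential (f : E → EReal) (x : E) : Set E :=
  {v | f x < ⊤ ∧ ∃ (y : ℕ → E) (w : ℕ → E),
    Tendsto y atTop (𝓝 x) ∧ Tendsto (fun t => f (y t)) atTop (𝓝 (f x)) ∧
    Tendsto w atTop (𝓝 v) ∧ ∀ t, w t ∈ regularSubdifferential f (y t)}

open Classical in
/-- The indicator function of a set: `0` on `S`, `+∞` outside. -/
def indicatorFun (S : Set E) (x : E) : EReal :=
  if x ∈ S then 0 else ⊤

/-- The regular normal cone of `S` at `x`. -/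
def regularNormalCone (S : Set E) (x : E) : Set E :=
  regularSubdifferential (indicatorFun S) x

/-- The limiting normal cone of `S` at `x`. -/
def normalCone (S : Set E) (x : E) : Set E :=
  subdifferential (indicatorFun S) x

/-- The epigraph of `f`, in the product `E × ℝ` with its Euclidean (`ℓ²`) structure. -/
def epigraph (f : E → EReal) : Set (WithLp 2 (E × ℝ)) :=
  {p | f p.fst ≤ ((p.snd : ℝ) : EReal)}

/-- `f` is (subdifferentially) regular at `x ∈ dom f`: its epigraph is regular at `(x, f x)`, that
is, the limiting and the regular normal cones of the epigraph coincide there. -/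
def IsRegularAt (f : E → EReal) (x : E) : Prop :=
  f x < ⊤ ∧
    normalCone (epigraph f) (WithLp.toLp 2 (x, (f x).toReal)) =
      regularNormalCone (epigraph f) (WithLp.toLp 2 (x, (f x).toReal))

/-- `f` is prox-regular at `a` for the subgradient `b`. -/
def IsProxRegularFor (f : E → EReal) (a b : E) : Prop :=
  f a < ⊤ ∧ ∃ ρ : ℝ, 0 ≤ ρ ∧ ∃ δ : ℝ, 0 < δ ∧ ∀ x x' v : E,
    ‖x - a‖ < δ → ‖x' - a‖ < δ →
    f a - (δ : EReal) < f x → f x < f a + (δ : EReal) →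
    v ∈ subdifferential f x → ‖v - b‖ < δ →
    f x + ((⟪v, x' - x⟫_ℝ - ρ / 2 * ‖x' - x‖ ^ 2 : ℝ) : EReal) ≤ f x'

/-- `f` is prox-regular at `a`: it is so for every subgradient `b ∈ ∂f(a)`. -/
def IsProxRegularAt (f : E → EReal) (a : E) : Prop :=
  f a < ⊤ ∧ ∀ b ∈ subdifferential f a, IsProxRegularFor f a b

/-- `M` is a `C²` manifold about `a ∈ M`: near `a` it is the solution set of finitely many `C²`
equations whose gradients at `a` are linearly independent. -/
def IsC2ManifoldAbout [CompleteSpace E] (M : Set E) (a : E) : Prop :=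
  a ∈ M ∧ ∃ (m : ℕ) (g : Fin m → E → ℝ) (U : Set E), IsOpen U ∧ a ∈ U ∧
    (∀ i, ContDiffOn ℝ 2 (g i) U) ∧
    LinearIndependent ℝ (fun i => gradient (g i) a) ∧
    M ∩ U = {x | x ∈ U ∧ ∀ i, g i x = 0}

/-- The tangent space of a manifold `M` at `x ∈ M`: the velocities at `x` of curves in `M`. -/
def tangentVectors (M : Set E) (x : E) : Set E :=
  {ξ | ∃ γ : ℝ → E, γ 0 = x ∧ (∀ᶠ t in 𝓝 (0 : ℝ), γ t ∈ M) ∧ HasDerivAt γ ξ 0}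

open Classical in
/-- The projection onto `M`: a nearest point of `M` to `z` (and `z` itself if there is none).
Near a point about which `M` is a `C²` manifold, the nearest point exists and is unique. -/
def proj (M : Set E) (z : E) : E :=
  if h : ∃ p ∈ M, ∀ q ∈ M, dist z p ≤ dist z q then h.choose else z

/-- `w` is the covariant derivative of `f` along `M` at `x`: it is tangent to `M` at `x`, and
`⟪w, ξ⟫` is the derivative of `t ↦ f (P_M (x + t ξ))` at `t = 0` for all tangent vectors `ξ`. -/
def IsCovariantGradient (M : Set E) (f : E → EReal) (x w : E) : Prop :=
  w ∈ tangentVectors M x ∧ ∀ ξ ∈ tangentVectors M x,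
    HasDerivAt (fun t : ℝ => (f (proj M (x + t • ξ))).toReal) ⟪w, ξ⟫_ℝ 0

open Classical in
/-- The covariant derivative `∇_M f(x)` (with the value `0` where it does not exist). -/
def covariantGradient (M : Set E) (f : E → EReal) (x : E) : E :=
  if h : ∃ w, IsCovariantGradient M f x w then h.choose else 0

/-- Continuity at `a`, relative to `M`, of a set-valued map `S` in the sense of
Painlevé-Kuratowski: inner semicontinuity and outer semicontinuity. -/
def SetValuedContinuousWithinAt (S : E → Set E) (M : Set E) (a : E) : Prop :=
  (∀ v ∈ S a, ∀ V ∈ 𝓝 v, ∀ᶠ x in 𝓝[M] a, (S x ∩ V).Nonempty) ∧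
  (∀ v, (∀ V ∈ 𝓝 v, ∃ᶠ x in 𝓝[M] a, (S x ∩ V).Nonempty) → v ∈ S a)

/-- `f` is `C²`-partly smooth at `a` relative to `M` (where `M` is a `C²` manifold about `a`). -/
structure IsC2PartlySmoothAt [CompleteSpace E] (f : E → EReal) (M : Set E) (a : E) : Prop where
  manifold : IsC2ManifoldAbout M a
  restricted_smoothness : ∃ (U : Set E) (g : E → ℝ), IsOpen U ∧ a ∈ U ∧ ContDiffOn ℝ 2 g U ∧
    ∀ x ∈ M ∩ U, f x = ((g x : ℝ) : EReal)
  regularity : ∀ᶠ x in 𝓝[M] a, IsRegularAt f x ∧ (subdifferential f x).Nonempty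
  normal_sharpness : ∃ b : E,
    (affineSpan ℝ (subdifferential f a) : Set E) = (fun u => b + u) '' normalCone M a
  subgradient_continuity : SetValuedContinuousWithinAt (subdifferential f) M a

/-- `f` has the Kurdyka-Łojasiewicz property at `a ∈ dom ∂f` with exponent `α`. The distance from
`0` to the empty set is `+∞`. -/
def HasKLExponentAt (f : E → EReal) (a : E) (α : ℝ) : Prop :=
  (subdifferential f a).Nonempty ∧
  ∃ (c ε : ℝ) (ν : EReal), 0 < c ∧ 0 < ε ∧ 0 < ν ∧
    ∀ x : E, ‖x - a‖ ≤ ε → f a < f x → f x < f a + ν →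
      ENNReal.ofReal (c * ((f x).toReal - (f a).toReal) ^ α) ≤
        Metric.infEDist 0 (subdifferential f x)

end

end VarAnalysis

/-!
The proof is an identification argument. Let `x` be near `a` with `f x` near `f a` and `v ∈ ∂f(x)`
small. If `x ∉ M`, the direction `u` from the projection `p` of `x` onto `M` to `x` is a unit normal
to `M` at `p`, so `u` is close to some unit `n ∈ N_M(a)`. As `0 ∈ ri ∂f(a)` and `N_M(a)` is parallel
to `∂f(a)`, a small multiple `t • n` lies in `∂f(a)`, and inner semicontinuity provides `y ∈ ∂f(p)`
close to `t • n`. Prox-regularity makes `∂f` hypomonotone, so `⟪y - v, u⟫ ≤ σ ‖x - p‖`; the left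
side is close to `t > 0` and the right side to `0`, a contradiction. Hence `x ∈ M`. There `v` is a
proximal subgradient of the restriction of `f` to `M`, so the covariant derivative is the tangential
part of `v` and is no longer than `v`. Subgradients that are not small satisfy the KL inequality
trivially, because `(f x - f a) ^ α` is bounded.
-/

section IntrinsicInterior

variable {V : Type*} [NormedAddCommGroup V] [NormedSpace ℝ V]

theorem eventually_add_smul_mem_of_mem_intrinsicInterior {S : Set V} {x v : V}
    (hx : x ∈ intrinsicInterior ℝ S) (hv : v ∈ vectorSpan ℝ S) :
    ∀ᶠ t : ℝ in 𝓝 0, x + t • v ∈ S := by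
  obtain ⟨y, hy, rfl⟩ := mem_intrinsicInterior.1 hx
  have hline (t : ℝ) : (y : V) + t • v ∈ affineSpan ℝ S := by
    rw [add_comm]
    refine AffineSubspace.vadd_mem_of_mem_direction ?_ y.2
    rw [direction_affineSpan]
    exact Submodule.smul_mem _ t hv
  have hcont : Continuous fun t : ℝ => (⟨y + t • v, hline t⟩ : affineSpan ℝ S) := by fun_prop
  have hmem : interior ((↑) ⁻¹' S : Set (affineSpan ℝ S)) ∈ 𝓝 ⟨y + (0 : ℝ) • v, hline 0⟩ := by
    simpa only [zero_smul, add_zero] using isOpen_interior.mem_nhds hy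
  filter_upwards [hcont.tendsto 0 hmem] with t ht
  exact interior_subset (s := ((↑) : affineSpan ℝ S → V) ⁻¹' S) ht

end IntrinsicInterior

namespace VarAnalysis

section NearestPoints

variable {E : Type*} [NormedAddCommGroup E] {M : Set E} {a x z p : E}

/-- `p` is a nearest point of `M` to `z`. Since `proj M z` is a junk value if `z` has no nearest
point in `M`, `IsNearestPoint M z (proj M z)` expresses that the projection of `z` is defined. -/
def IsNearestPoint (M : Set E) (z p : E) : Prop :=
  p ∈ M ∧ ∀ q ∈ M, dist z p ≤ dist z q

theorem IsNearestPoint.proj (h : IsNearestPoint M z p) : IsNearestPoint M z (proj M z) := by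
  have hex : ∃ p ∈ M, ∀ q ∈ M, dist z p ≤ dist z q := ⟨p, h⟩
  rw [VarAnalysis.proj, dif_pos hex]
  exact hex.choose_spec

theorem isNearestPoint_self (hx : x ∈ M) : IsNearestPoint M x x :=
  ⟨hx, fun q _ => by simp only [dist_self, dist_nonneg]⟩

theorem proj_eq_self (hx : x ∈ M) : proj M x = x := by
  have h := (isNearestPoint_self hx).proj.2 x hx
  rw [dist_self] at h
  exact (dist_le_zero.1 h).symm

theorem eventually_isNearestPoint_proj [ProperSpace E] (ha : a ∈ M)
    (hM : ∃ V ∈ 𝓝 a, IsClosed (M ∩ V)) : ∀ᶠ z in 𝓝 a, IsNearestPoint M z (proj M z) := by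
  obtain ⟨V, hV, hclosed⟩ := hM
  obtain ⟨r, hr, hrV⟩ := Metric.nhds_basis_ball.mem_iff.1 hV
  filter_upwards [Metric.ball_mem_nhds a (half_pos hr)] with z hz
  rw [Metric.mem_ball] at hz
  have haV : a ∈ M ∩ V := ⟨ha, mem_of_mem_nhds hV⟩
  obtain ⟨p, hp, hzp⟩ := hclosed.exists_infDist_eq_dist ⟨a, haV⟩ z
  have hmin : ∀ q ∈ M ∩ V, dist z p ≤ dist z q := fun q hq => hzp ▸ Metric.infDist_le_dist_of_mem hq
  refine IsNearestPoint.proj (p := p) ⟨hp.1, fun q hq => ?_⟩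
  by_cases hqr : q ∈ Metric.ball a r
  · exact hmin q ⟨hq, hrV hqr⟩
  · have hzpa := hmin a haV
    have htri := dist_triangle_left q a z
    rw [Metric.mem_ball, not_lt] at hqr
    linarith

theorem tendsto_proj (ha : a ∈ M) (hproj : ∀ᶠ z in 𝓝 a, IsNearestPoint M z (proj M z)) :
    Tendsto (proj M) (𝓝 a) (𝓝[M] a) := by
  refine tendsto_nhdsWithin_iff.2 ⟨?_, hproj.mono fun z hz => hz.1⟩
  have hdist : Tendsto (fun z => 2 * dist z a) (𝓝 a) (𝓝 0) := by
    simpa using (tendsto_iff_dist_tendsto_zero.1 (tendsto_id (x := 𝓝 a))).const_mul 2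
  refine tendsto_iff_dist_tendsto_zero.2 (squeeze_zero' (.of_forall fun _ => dist_nonneg) ?_ hdist)
  filter_upwards [hproj] with z hz
  linarith [hz.2 a ha, dist_triangle_left (proj M z) a z]

/-- The direction from the projection of `z` onto `M` to `z`; it is `0` for `z ∈ M`. -/
noncomputable def unitNormal [NormedSpace ℝ E] (M : Set E) (z : E) : E :=
  ‖z - proj M z‖⁻¹ • (z - proj M z)

theorem norm_unitNormal [NormedSpace ℝ E] (h : z ≠ proj M z) : ‖unitNormal M z‖ = 1 :=
  norm_smul_inv_norm (𝕜 := ℝ) (sub_ne_zero.2 h)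

theorem norm_smul_unitNormal [NormedSpace ℝ E] (h : z ≠ proj M z) :
    ‖z - proj M z‖ • unitNormal M z = z - proj M z :=
  smul_inv_smul₀ (norm_ne_zero_iff.2 (sub_ne_zero.2 h)) _

end NearestPoints

section Hemicontinuity

variable {E : Type*} [NormedAddCommGroup E] {M : Set E} {a : E}

theorem SetValuedContinuousWithinAt.lowerHemicontinuousWithinAt {S : E → Set E}
    (h : SetValuedContinuousWithinAt S M a) : LowerHemicontinuousWithinAt S M a := by
  rintro V ⟨hV, v, hv, hvV⟩
  exact (h.1 v hv V (hV.mem_nhds hvV)).mono fun x hx => ⟨hV, hx⟩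

end Hemicontinuity

variable {E : Type*} [NormedAddCommGroup E] [InnerProductSpace ℝ E]
variable {f : E → EReal} {M : Set E} {a b x z p v w : E}

section NormalCones

theorem IsNearestPoint.inner_le (h : IsNearestPoint M z p) {q : E} (hq : q ∈ M) :
    ⟪z - p, q - p⟫_ℝ ≤ 1 / 2 * ‖q - p‖ ^ 2 := by
  have hdist := h.2 q hq
  rw [dist_eq_norm, dist_eq_norm] at hdist
  have hsq : ‖z - p‖ ^ 2 ≤ ‖z - q‖ ^ 2 := by gcongr
  have hexpand : ‖z - q‖ ^ 2 = ‖z - p‖ ^ 2 - 2 * ⟪z - p, q - p⟫_ℝ + ‖q - p‖ ^ 2 := by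
    rw [← norm_sub_sq_real, sub_sub_sub_cancel_right]
  linarith

theorem mem_regularSubdifferential_of_eventually_le {σ : ℝ} (hbot : f x ≠ ⊥) (htop : f x < ⊤)
    (h : ∀ᶠ z in 𝓝 x, f x + ((⟪v, z - x⟫_ℝ - σ * ‖z - x‖ ^ 2 : ℝ) : EReal) ≤ f z) :
    v ∈ regularSubdifferential f x := by
  refine ⟨htop, le_of_forall_lt_imp_le_of_dense fun c hc =>
    le_liminf_of_le (by isBoundedDefault) ?_⟩
  have hlim : Tendsto (fun z => ((-(σ * ‖z - x‖) : ℝ) : EReal)) (𝓝 x) (𝓝 0) := by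
    have hreal : Tendsto (fun z => -(σ * ‖z - x‖)) (𝓝 x) (𝓝 0) :=
      Continuous.tendsto' (by fun_prop) x 0 (by simp)
    exact (continuous_coe_real_ereal.tendsto 0).comp hreal
  filter_upwards [nhdsWithin_le_nhds (hlim.eventually_const_lt hc), nhdsWithin_le_nhds h,
    self_mem_nhdsWithin] with z hcz hz hzx
  have hpos : 0 < ‖z - x‖ := norm_pos_iff.2 (sub_ne_zero.2 hzx)
  refine hcz.le.trans ?_
  rw [EReal.le_div_iff_mul_le (by exact_mod_cast hpos) (EReal.coe_ne_top _),
    EReal.le_sub_iff_add_le (.inl (EReal.coe_ne_bot _)) (.inl (EReal.coe_ne_top _)),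
    EReal.le_sub_iff_add_le (.inl hbot) (.inl htop.ne), ← EReal.coe_mul, ← EReal.coe_add, add_comm]
  convert hz using 3
  ring

theorem mem_regularNormalCone_of_inner_le {σ : ℝ} (hp : p ∈ M)
    (h : ∀ q ∈ M, ⟪w, q - p⟫_ℝ ≤ σ * ‖q - p‖ ^ 2) : w ∈ regularNormalCone M p := by
  have hp0 : indicatorFun M p = 0 := if_pos hp
  refine mem_regularSubdifferential_of_eventually_le (σ := σ) (by simp [hp0]) (by simp [hp0])
    (.of_forall fun q => ?_)
  by_cases hq : q ∈ M
  · rw [hp0, indicatorFun, if_pos hq, zero_add]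
    exact_mod_cast sub_nonpos.2 (h q hq)
  · exact le_top.trans_eq (if_neg hq).symm

theorem IsNearestPoint.smul_sub_mem_regularNormalCone (h : IsNearestPoint M z p) {s : ℝ}
    (hs : 0 ≤ s) : s • (z - p) ∈ regularNormalCone M p := by
  refine mem_regularNormalCone_of_inner_le (σ := s * (1 / 2)) h.1 fun q hq => ?_
  rw [real_inner_smul_left, mul_assoc]
  exact mul_le_mul_of_nonneg_left (h.inner_le hq) hs

theorem unitNormal_mem_regularNormalCone (h : IsNearestPoint M z (proj M z)) :
    unitNormal M z ∈ regularNormalCone M (proj M z) :=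
  h.smul_sub_mem_regularNormalCone (inv_nonneg.2 (norm_nonneg _))

theorem mem_normalCone_of_mem_closure (ha : a ∈ M)
    (h : (a, v) ∈ closure {q : E × E | q.2 ∈ regularNormalCone M q.1}) : v ∈ normalCone M a := by
  obtain ⟨q, hq, hlim⟩ := mem_closure_iff_seq_limit.1 h
  have hqM (k : ℕ) : (q k).1 ∈ M := by
    by_contra hk
    exact (hq k).1.ne (if_neg hk)
  refine ⟨by simp [indicatorFun, ha], fun k => (q k).1, fun k => (q k).2, hlim.fst_nhds, ?_,
    hlim.snd_nhds, hq⟩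
  simp [indicatorFun, ha, hqM]

theorem regularNormalCone_subset_normalCone (ha : a ∈ M) :
    regularNormalCone M a ⊆ normalCone M a :=
  fun _ hv => mem_normalCone_of_mem_closure ha (subset_closure hv)

theorem zero_mem_normalCone (ha : a ∈ M) : (0 : E) ∈ normalCone M a :=
  regularNormalCone_subset_normalCone ha
    (mem_regularNormalCone_of_inner_le (σ := 0) ha (by simp))

theorem exists_tendsto_unitNormal [ProperSpace E] (ha : a ∈ M)
    (hproj : ∀ᶠ z in 𝓝 a, IsNearestPoint M z (proj M z)) {U : Ultrafilter E}
    (hU : (U : Filter E) ≤ 𝓝[Mᶜ] a) :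
    ∃ n ∈ normalCone M a, ‖n‖ = 1 ∧ Tendsto (unitNormal M) U (𝓝 n) := by
  have hUa : (U : Filter E) ≤ 𝓝 a := hU.trans nhdsWithin_le_nhds
  have hsphere : ∀ᶠ z in (U : Filter E), unitNormal M z ∈ Metric.sphere (0 : E) 1 := by
    filter_upwards [hUa hproj, hU self_mem_nhdsWithin] with z hz hzM
    rw [mem_sphere_zero_iff_norm]
    exact norm_unitNormal fun h => hzM (h ▸ hz.1)
  obtain ⟨n, hn, hlim⟩ := (isCompact_sphere (0 : E) 1).ultrafilter_le_nhds'
    (U.map (unitNormal M)) hsphere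
  refine ⟨n, mem_normalCone_of_mem_closure ha ?_, mem_sphere_zero_iff_norm.1 hn, hlim⟩
  have hpair : Tendsto (fun z => (proj M z, unitNormal M z)) U (𝓝 (a, n)) :=
    (((tendsto_proj ha hproj).mono_right nhdsWithin_le_nhds).mono_left hUa).prodMk_nhds hlim
  exact mem_closure_of_tendsto hpair
    ((hproj.filter_mono hUa).mono fun z hz => unitNormal_mem_regularNormalCone hz)

end NormalCones

section AttentiveConvergence

/-- The filter of `f`-attentive convergence to `(a, b)` in the graph of the subdifferential of `f`:
`(x, v) → (a, b)` with `f x → f a` and `v ∈ ∂f(x)`. -/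
noncomputable def subgradientNhds (f : E → EReal) (a b : E) : Filter (E × E) :=
  (𝓝 a ⊓ comap f (𝓝 (f a))) ×ˢ 𝓝 b ⊓ 𝓟 {q | q.2 ∈ subdifferential f q.1}

theorem tendsto_fst_subgradientNhds : Tendsto Prod.fst (subgradientNhds f a b) (𝓝 a) :=
  (tendsto_fst.mono_left inf_le_left).mono_right inf_le_left

theorem tendsto_snd_subgradientNhds : Tendsto Prod.snd (subgradientNhds f a b) (𝓝 b) :=
  tendsto_snd.mono_left inf_le_left

theorem tendsto_apply_fst_subgradientNhds :
    Tendsto (fun q => f q.1) (subgradientNhds f a b) (𝓝 (f a)) :=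
  tendsto_comap.comp ((tendsto_fst.mono_left inf_le_left).mono_right inf_le_right)

theorem eventually_ne_bot_and_ne_top_subgradientNhds (hbot : f a ≠ ⊥) (htop : f a < ⊤) :
    ∀ᶠ q in subgradientNhds f a b, f q.1 ≠ ⊥ ∧ f q.1 ≠ ⊤ :=
  (tendsto_apply_fst_subgradientNhds.eventually_ne hbot).and
    (tendsto_apply_fst_subgradientNhds.eventually_ne htop.ne)

theorem hasBasis_nhds_coe_ereal (r : ℝ) :
    (𝓝 (r : EReal)).HasBasis (fun δ : ℝ => 0 < δ)
      fun δ => Ioo ((r : EReal) - (δ : EReal)) ((r : EReal) + (δ : EReal)) := by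
  rw [EReal.nhds_coe]
  simpa only [EReal.image_coe_Ioo, EReal.coe_sub, EReal.coe_add] using
    (nhds_basis_Ioo_pos r).map Real.toEReal

theorem hasBasis_subgradientNhds (hbot : f a ≠ ⊥) (htop : f a < ⊤) :
    (subgradientNhds f a b).HasBasis (fun δ : ℝ => 0 < δ) fun δ =>
      {q | ‖q.1 - a‖ < δ ∧ f a - (δ : EReal) < f q.1 ∧ f q.1 < f a + (δ : EReal) ∧
        ‖q.2 - b‖ < δ ∧ q.2 ∈ subdifferential f q.1} := by
  lift f a to ℝ using ⟨htop.ne, hbot⟩ with r hr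
  rw [subgradientNhds, ← hr]
  refine (((Metric.nhds_basis_ball.inf ((hasBasis_nhds_coe_ereal r).comap f)).prod
    Metric.nhds_basis_ball).inf_principal _).to_hasBasis ?_ fun δ hδ => ?_
  · rintro ⟨⟨δ₁, δ₂⟩, δ₃⟩ ⟨⟨hδ₁, hδ₂⟩, hδ₃⟩
    refine ⟨min δ₁ (min δ₂ δ₃), lt_min hδ₁ (lt_min hδ₂ hδ₃), ?_⟩
    rintro q ⟨hqa, hlo, hhi, hqb, hq⟩
    have hle : ((min δ₁ (min δ₂ δ₃) : ℝ) : EReal) ≤ δ₂ :=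
      EReal.coe_le_coe ((min_le_right _ _).trans (min_le_left _ _))
    simp only [lt_min_iff] at hqa hqb
    refine ⟨⟨⟨mem_ball_iff_norm.2 hqa.1, ?_, ?_⟩, mem_ball_iff_norm.2 hqb.2.2⟩, hq⟩
    · exact (EReal.sub_le_sub le_rfl hle).trans_lt hlo
    · exact hhi.trans_le (add_le_add le_rfl hle)
  · refine ⟨⟨⟨δ, δ⟩, δ⟩, ⟨⟨hδ, hδ⟩, hδ⟩, ?_⟩
    rintro q ⟨⟨⟨hqa, hlo, hhi⟩, hqb⟩, hq⟩
    exact ⟨mem_ball_iff_norm.1 hqa, hlo, hhi, mem_ball_iff_norm.1 hqb, hq⟩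

/-- Inner semicontinuity supplies the points `y ∈ ∂f(p i)` near `b`. -/
theorem eventually_exists_of_eventually_prod_subgradientNhds {ι : Type*} {l : Filter ι} {p : ι → E}
    (hp : Tendsto p l (𝓝[M] a)) (hcont : ContinuousWithinAt f M a)
    (hinner : LowerHemicontinuousWithinAt (subdifferential f) M a)
    (hb : b ∈ subdifferential f a) {P : ι × E × E → Prop}
    (hP : ∀ᶠ r in l ×ˢ subgradientNhds f a b, P r) : ∀ᶠ i in l, ∃ y, P (i, p i, y) := by
  obtain ⟨A, hA, B, hB, hAB⟩ := eventually_prod_iff.1 hP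
  obtain ⟨C, hC, D, hD, hCD⟩ := eventually_prod_iff.1 (eventually_inf_principal.1 hB)
  obtain ⟨V, hVD, hVopen, hbV⟩ := eventually_nhds_iff.1 hD
  have hattentive : Tendsto p l (𝓝 a ⊓ comap f (𝓝 (f a))) :=
    hp.mono_right (le_inf nhdsWithin_le_nhds hcont.tendsto.le_comap)
  filter_upwards [hA, hattentive.eventually hC, hp.eventually (hinner V ⟨hVopen, b, hb, hbV⟩)]
    with i hi hpi hV
  obtain ⟨-, y, hy, hyV⟩ := hV
  exact ⟨y, hAB hi (hCD hpi (hVD y hyV) hy)⟩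

end AttentiveConvergence

section ProxRegular

theorem IsProxRegularFor.exists_eventually_le (h : IsProxRegularFor f a b) (hbot : f a ≠ ⊥) :
    ∃ ρ : ℝ, ∀ᶠ r in subgradientNhds f a b ×ˢ 𝓝 a,
      f r.1.1 + ((⟪r.1.2, r.2 - r.1.1⟫_ℝ - ρ / 2 * ‖r.2 - r.1.1‖ ^ 2 : ℝ) : EReal) ≤ f r.2 := by
  obtain ⟨htop, ρ, -, δ, hδ, hle⟩ := h
  refine ⟨ρ, ?_⟩
  filter_upwards [prod_mem_prod ((hasBasis_subgradientNhds hbot htop).mem_of_mem hδ)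
    (Metric.ball_mem_nhds a hδ)] with r hr
  obtain ⟨⟨hxa, hlo, hhi, hvb, hv⟩, hya⟩ := hr
  exact hle _ _ _ hxa (mem_ball_iff_norm.1 hya) hlo hhi hv hvb

/-- Adding the two subgradient inequalities cancels the function values. -/
theorem IsProxRegularFor.exists_eventually_inner_le {c : E} (hb : IsProxRegularFor f a b)
    (hc : IsProxRegularFor f a c) (hbot : f a ≠ ⊥) :
    ∃ σ : ℝ, ∀ᶠ r in subgradientNhds f a b ×ˢ subgradientNhds f a c,
      ⟪r.2.2 - r.1.2, r.1.1 - r.2.1⟫_ℝ ≤ σ * ‖r.1.1 - r.2.1‖ ^ 2 := by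
  have htop := hb.1
  obtain ⟨ρ, hρ⟩ := hb.exists_eventually_le hbot
  obtain ⟨τ, hτ⟩ := hc.exists_eventually_le hbot
  refine ⟨(ρ + τ) / 2, ?_⟩
  filter_upwards [(tendsto_id.prodMap tendsto_fst_subgradientNhds).eventually hρ,
    (tendsto_snd.prodMk (tendsto_fst_subgradientNhds.comp tendsto_fst)).eventually hτ,
    tendsto_fst.eventually (eventually_ne_bot_and_ne_top_subgradientNhds hbot htop),
    tendsto_snd.eventually (eventually_ne_bot_and_ne_top_subgradientNhds hbot htop)]
    with r h₁ h₂ hfin₁ hfin₂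
  obtain ⟨⟨x, v⟩, y, w⟩ := r
  simp only [id, Prod.map, Function.comp_apply] at h₁ h₂ hfin₁ hfin₂ ⊢
  lift f x to ℝ using hfin₁.symm with s
  lift f y to ℝ using hfin₂.symm with t
  norm_cast at h₁ h₂
  rw [← neg_sub x y, inner_neg_right, norm_neg] at h₁
  rw [inner_sub_left]
  linarith

end ProxRegular

section CovariantGradient

/-- Since `proj M (x + t • ξ)` is nearest, it is no further from `x + t • ξ` than any curve in `M`
with velocity `ξ`. -/
theorem hasDerivAt_proj_of_mem_tangentVectors {ξ : E} (hx : x ∈ M) (hξ : ξ ∈ tangentVectors M x)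
    (hproj : ∀ᶠ z in 𝓝 x, IsNearestPoint M z (proj M z)) :
    HasDerivAt (fun t : ℝ => proj M (x + t • ξ)) ξ 0 := by
  obtain ⟨γ, hγ0, hγM, hγ⟩ := hξ
  have hline : Tendsto (fun t : ℝ => x + t • ξ) (𝓝 0) (𝓝 x) :=
    Continuous.tendsto' (by fun_prop) 0 x (by simp)
  rw [hasDerivAt_iff_isLittleO] at hγ ⊢
  refine Asymptotics.IsBigO.trans_isLittleO (.of_bound 1 ?_) hγ
  filter_upwards [hγM, hline.eventually hproj] with t htM ht
  have hle := ht.2 _ htM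
  rw [dist_comm, dist_comm _ (γ t), dist_eq_norm, dist_eq_norm] at hle
  simpa [proj_eq_self hx, hγ0, sub_sub] using hle

theorem IsCovariantGradient.inner_eq_of_eventually_le {ξ : E} {ρ : ℝ} (hx : x ∈ M)
    (hw : IsCovariantGradient M f x w) (hξ : ξ ∈ tangentVectors M x)
    (hproj : ∀ᶠ z in 𝓝 x, IsNearestPoint M z (proj M z))
    (hv : ∀ᶠ y in 𝓝[M] x,
      (f x).toReal + (⟪v, y - x⟫_ℝ - ρ / 2 * ‖y - x‖ ^ 2) ≤ (f y).toReal) :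
    ⟪w, ξ⟫_ℝ = ⟪v, ξ⟫_ℝ := by
  set γ : ℝ → E := fun t => proj M (x + t • ξ)
  have hγ0 : γ 0 = x := by simpa [γ] using proj_eq_self hx
  have hγ : HasDerivAt γ ξ 0 := hasDerivAt_proj_of_mem_tangentVectors hx hξ hproj
  have hγM : Tendsto γ (𝓝 0) (𝓝[M] x) :=
    (tendsto_proj hx hproj).comp (Continuous.tendsto' (by fun_prop) 0 x (by simp))
  have hderiv : HasDerivAt
      (fun t => (f (γ t)).toReal - ⟪v, γ t - x⟫_ℝ + ρ / 2 * ‖γ t - x‖ ^ 2)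
      (⟪w, ξ⟫_ℝ - ⟪v, ξ⟫_ℝ) 0 := by
    have hsub := hγ.sub_const x
    exact (((hw.2 ξ hξ).sub ((hasDerivAt_const (0 : ℝ) v).inner ℝ hsub)).add
      (hsub.norm_sq.const_mul (ρ / 2))).congr_deriv (by simp [hγ0])
  have hmin : IsLocalMin
      (fun t => (f (γ t)).toReal - ⟪v, γ t - x⟫_ℝ + ρ / 2 * ‖γ t - x‖ ^ 2) 0 := by
    filter_upwards [hγM.eventually hv] with t ht
    simp only [hγ0, sub_self, inner_zero_right, norm_zero]
    linarith
  exact sub_eq_zero.1 (hmin.hasDerivAt_eq_zero hderiv)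

theorem norm_covariantGradient_le_of_eventually_le {ρ : ℝ} (hx : x ∈ M)
    (hproj : ∀ᶠ z in 𝓝 x, IsNearestPoint M z (proj M z))
    (hv : ∀ᶠ y in 𝓝[M] x,
      (f x).toReal + (⟪v, y - x⟫_ℝ - ρ / 2 * ‖y - x‖ ^ 2) ≤ (f y).toReal) :
    ‖covariantGradient M f x‖ ≤ ‖v‖ := by
  by_cases hex : ∃ w, IsCovariantGradient M f x w
  · rw [covariantGradient, dif_pos hex]
    set w := hex.choose
    have hw : IsCovariantGradient M f x w := hex.choose_spec
    rcases (norm_nonneg w).eq_or_lt with hw0 | hw0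
    · exact hw0 ▸ norm_nonneg v
    · refine le_of_mul_le_mul_right ?_ hw0
      rw [← real_inner_self_eq_norm_mul_norm, hw.inner_eq_of_eventually_le hx hw.1 hproj hv]
      exact real_inner_le_norm v w
  · rw [covariantGradient, dif_neg hex, norm_zero]
    exact norm_nonneg v

end CovariantGradient

section Identification

theorem eventually_mul_norm_sub_lt_inner {ι : Type*} {l : Filter ι} {x v u : ι → E} {c n : E}
    (hx : Tendsto x l (𝓝 a)) (hv : Tendsto v l (𝓝 c)) (hu : Tendsto u l (𝓝 n))
    (hpos : 0 < ⟪b - c, n⟫_ℝ) (σ : ℝ) :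
    ∀ᶠ r in l ×ˢ subgradientNhds f a b, σ * ‖x r.1 - r.2.1‖ < ⟪r.2.2 - v r.1, u r.1⟫_ℝ := by
  have hy : Tendsto (fun r : ι × E × E => r.2.1) (l ×ˢ subgradientNhds f a b) (𝓝 a) :=
    tendsto_fst_subgradientNhds.comp tendsto_snd
  have hw : Tendsto (fun r : ι × E × E => r.2.2) (l ×ˢ subgradientNhds f a b) (𝓝 b) :=
    tendsto_snd_subgradientNhds.comp tendsto_snd
  have hleft : Tendsto (fun r : ι × E × E => σ * ‖x r.1 - r.2.1‖)
      (l ×ˢ subgradientNhds f a b) (𝓝 0) := by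
    simpa using ((hx.comp tendsto_fst).sub hy).norm.const_mul σ
  have hright := (hw.sub (hv.comp tendsto_fst)).inner (𝕜 := ℝ) (hu.comp tendsto_fst)
  exact hleft.eventually_lt hright hpos

theorem eventually_fst_mem_subgradientNhds_zero [ProperSpace E] (ha : a ∈ M)
    (hproj : ∀ᶠ z in 𝓝 a, IsNearestPoint M z (proj M z)) (hbot : f a ≠ ⊥)
    (hcont : ContinuousWithinAt f M a) (hprox : IsProxRegularAt f a)
    (hnormal : normalCone M a ⊆ vectorSpan ℝ (subdifferential f a))
    (hinner : LowerHemicontinuousWithinAt (subdifferential f) M a)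
    (hri : (0 : E) ∈ intrinsicInterior ℝ (subdifferential f a)) :
    ∀ᶠ q in subgradientNhds f a 0, q.1 ∈ M := by
  refine mem_iff_ultrafilter.2 fun U hU => ?_
  by_contra hUM
  have hoff : ∀ᶠ q in (U : Filter (E × E)), q.1 ∉ M := Ultrafilter.eventually_not.2 hUM
  have hx : Tendsto Prod.fst (U : Filter (E × E)) (𝓝 a) := tendsto_fst_subgradientNhds.mono_left hU
  have hv : Tendsto Prod.snd (U : Filter (E × E)) (𝓝 0) := tendsto_snd_subgradientNhds.mono_left hU
  obtain ⟨n, hn, hn1, hlim⟩ := exists_tendsto_unitNormal ha hproj (U := U.map Prod.fst)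
    (tendsto_nhdsWithin_iff.2 ⟨hx, hoff⟩)
  obtain ⟨t, htn, ht⟩ : ∃ t : ℝ, t • n ∈ subdifferential f a ∧ 0 < t := by
    have hsmall := eventually_add_smul_mem_of_mem_intrinsicInterior hri (hnormal hn)
    simp only [zero_add] at hsmall
    exact ((hsmall.filter_mono nhdsWithin_le_nhds).and self_mem_nhdsWithin).exists (f := 𝓝[>] 0)
  obtain ⟨σ, hmono⟩ := (hprox.2 0 (intrinsicInterior_subset hri)).exists_eventually_inner_le
    (hprox.2 _ htn) hbot
  have hsep := eventually_mul_norm_sub_lt_inner (f := f) (b := t • n) hx hv hlim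
    (by simpa [real_inner_smul_left, hn1] using ht) σ
  have hp : Tendsto (fun q => proj M q.1) (U : Filter (E × E)) (𝓝[M] a) :=
    (tendsto_proj ha hproj).comp hx
  obtain ⟨q, ⟨y, hlt, hle⟩, hqM, hq⟩ := ((eventually_exists_of_eventually_prod_subgradientNhds
    hp hcont hinner htn (hsep.and (hmono.filter_mono (prod_mono_left _ hU)))).and
    (hoff.and (hx.eventually hproj))).exists
  have hne : q.1 ≠ proj M q.1 := fun h => hqM (h ▸ hq.1)
  have hdist : 0 < ‖q.1 - proj M q.1‖ := norm_pos_iff.2 (sub_ne_zero.2 hne)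
  have hdecomp : ⟪y - q.2, q.1 - proj M q.1⟫_ℝ =
      ‖q.1 - proj M q.1‖ * ⟪y - q.2, unitNormal M q.1⟫_ℝ := by
    rw [← real_inner_smul_right, norm_smul_unitNormal hne]
  have hmul := mul_lt_mul_of_pos_left hlt hdist
  linarith

theorem eventually_norm_covariantGradient_le (hprox : IsProxRegularFor f a b) (hbot : f a ≠ ⊥)
    (hcont : ContinuousWithinAt f M a) (hproj : ∀ᶠ z in 𝓝 a, IsNearestPoint M z (proj M z))
    (hmem : ∀ᶠ q in subgradientNhds f a b, q.1 ∈ M) :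
    ∀ᶠ q in subgradientNhds f a b, ‖covariantGradient M f q.1‖ ≤ ‖q.2‖ := by
  obtain ⟨ρ, hρ⟩ := hprox.exists_eventually_le hbot
  obtain ⟨A, hA, B, hB, hAB⟩ := eventually_prod_iff.1 hρ
  have hfinite : ∀ᶠ y in 𝓝[M] a, f y ≠ ⊥ ∧ f y ≠ ⊤ :=
    (hcont.eventually_ne hbot).and (hcont.eventually_ne hprox.1.ne)
  have hfst : Tendsto Prod.fst (subgradientNhds f a b) (𝓝[M] a) :=
    tendsto_nhdsWithin_iff.2 ⟨tendsto_fst_subgradientNhds, hmem⟩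
  filter_upwards [hA, hmem, tendsto_fst_subgradientNhds.eventually hproj.eventually_nhds,
    hfst.eventually (eventually_eventually_nhdsWithin.2
      ((hB.filter_mono nhdsWithin_le_nhds).and hfinite))] with q hqA hqM hqproj hlocal
  have hqfinite := (hlocal.self_of_nhdsWithin hqM).2
  refine norm_covariantGradient_le_of_eventually_le (ρ := ρ) hqM hqproj ?_
  filter_upwards [hlocal] with y hy
  have hle := hAB hqA hy.1
  rw [← EReal.coe_toReal hqfinite.2 hqfinite.1, ← EReal.coe_toReal hy.2.2 hy.2.1] at hle
  exact_mod_cast hle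

end Identification

section KLProperty

theorem hasKLExponentAt_of_eventually {α c : ℝ} (hbot : f a ≠ ⊥) (h0 : 0 ∈ subdifferential f a)
    (hα : 0 ≤ α) (hc : 0 < c)
    (h : ∀ᶠ q in subgradientNhds f a 0,
      f a < f q.1 → c * ((f q.1).toReal - (f a).toReal) ^ α ≤ ‖q.2‖) :
    HasKLExponentAt f a α := by
  obtain ⟨δ, hδ, hle⟩ := (hasBasis_subgradientNhds hbot h0.1).eventually_iff.1 h
  have hκ : 0 < min δ 1 := lt_min hδ one_pos
  set κ := min δ 1
  have hκδ : κ ≤ δ := min_le_left _ _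
  refine ⟨⟨0, h0⟩, min c κ, κ / 2, κ, lt_min hc hκ, half_pos hκ, by exact_mod_cast hκ,
    fun x hx hlo hhi => Metric.le_infEDist.2 fun v hv => ?_⟩
  have hsmall : ‖v‖ < κ → c * ((f x).toReal - (f a).toReal) ^ α ≤ ‖v‖ := fun hvκ => by
    refine hle (x := (x, v)) ⟨by linarith, ?_, ?_, by simpa using hvκ.trans_le hκδ, hv⟩ hlo
    · lift f a to ℝ using ⟨h0.1.ne, hbot⟩ with r
      exact lt_trans (by exact_mod_cast sub_lt_self r hδ) hlo
    · exact hhi.trans_le (add_le_add le_rfl (EReal.coe_le_coe hκδ))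
  lift f a to ℝ using ⟨h0.1.ne, hbot⟩ with r
  lift f x to ℝ using ⟨hhi.ne_top, (bot_le.trans_lt hlo).ne'⟩ with s
  norm_cast at hlo hhi
  simp only [EReal.toReal_coe] at hsmall ⊢
  have hpow0 : 0 ≤ (s - r) ^ α := Real.rpow_nonneg (sub_nonneg.2 hlo.le) α
  have hpow1 : (s - r) ^ α ≤ 1 :=
    Real.rpow_le_one (sub_nonneg.2 hlo.le) (by linarith [min_le_right δ 1]) hα
  rw [edist_comm, edist_dist, dist_zero_right]
  refine ENNReal.ofReal_le_ofReal ?_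
  rcases lt_or_ge ‖v‖ κ with hvκ | hvκ
  · exact (mul_le_mul_of_nonneg_right (min_le_left c κ) hpow0).trans (hsmall hvκ)
  · calc min c κ * (s - r) ^ α ≤ κ * 1 := by
          gcongr
          exact min_le_right c κ
      _ ≤ ‖v‖ := by rwa [mul_one]

end KLProperty

section PartlySmooth

theorem IsC2ManifoldAbout.exists_nhds_isClosed_inter [CompleteSpace E]
    (hM : IsC2ManifoldAbout M a) : ∃ V ∈ 𝓝 a, IsClosed (M ∩ V) := by
  obtain ⟨-, m, g, U, hU, haU, hg, -, hMU⟩ := hM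
  obtain ⟨V, hV, hVclosed, hVU⟩ := exists_mem_nhds_isClosed_subset (hU.mem_nhds haU)
  refine ⟨V, hV, ?_⟩
  have hsolution : M ∩ V = V ∩ (fun x i => g i x) ⁻¹' {0} := by
    ext x
    have hx := Set.ext_iff.1 hMU x
    simp only [mem_inter_iff, mem_ofPred_eq, mem_preimage, mem_singleton_iff, funext_iff,
      Pi.zero_apply] at hx ⊢
    have hxU := @hVU x
    tauto
  rw [hsolution]
  refine ContinuousOn.preimage_isClosed_of_isClosed ?_ hVclosed isClosed_singleton
  exact continuousOn_pi.2 fun i => (hg i).continuousOn.mono hVU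

theorem IsC2PartlySmoothAt.continuousWithinAt [CompleteSpace E] (h : IsC2PartlySmoothAt f M a) :
    ContinuousWithinAt f M a := by
  obtain ⟨U, g, hU, haU, hg, hfg⟩ := h.restricted_smoothness
  have hcont : ContinuousAt (fun x => (g x : EReal)) a :=
    continuous_coe_real_ereal.continuousAt.comp (hg.continuousOn.continuousAt (hU.mem_nhds haU))
  refine hcont.continuousWithinAt.congr_of_eventuallyEq ?_ (hfg a ⟨h.manifold.1, haU⟩)
  filter_upwards [self_mem_nhdsWithin, mem_nhdsWithin_of_mem_nhds (hU.mem_nhds haU)] with x hx hxU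
  exact hfg x ⟨hx, hxU⟩

theorem IsC2PartlySmoothAt.normalCone_subset_vectorSpan [CompleteSpace E]
    (h : IsC2PartlySmoothAt f M a) :
    normalCone M a ⊆ vectorSpan ℝ (subdifferential f a) := by
  obtain ⟨b, hb⟩ := h.normal_sharpness
  have hspan (u : E) (hu : u ∈ normalCone M a) : b + u ∈ affineSpan ℝ (subdifferential f a) :=
    hb.symm.subset (mem_image_of_mem _ hu)
  intro u hu
  have hsub := AffineSubspace.vsub_mem_direction (hspan u hu)
    (hspan 0 (zero_mem_normalCone h.manifold.1))
  rwa [direction_affineSpan, vsub_eq_sub, add_zero, add_sub_cancel_left] at hsub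

end PartlySmooth

end VarAnalysis

open VarAnalysis in
theorem mainTheorem10_general {E : Type*} [NormedAddCommGroup E] [InnerProductSpace ℝ E]
    [ProperSpace E] {f : E → EReal} {a : E} {M : Set E} {α : ℝ} (ha : a ∈ M)
    (hM : ∃ V ∈ 𝓝 a, IsClosed (M ∩ V)) (hbot : f a ≠ ⊥) (hcont : ContinuousWithinAt f M a)
    (hprox : IsProxRegularAt f a) (hnormal : normalCone M a ⊆ vectorSpan ℝ (subdifferential f a))
    (hinner : LowerHemicontinuousWithinAt (subdifferential f) M a)
    (hri : (0 : E) ∈ intrinsicInterior ℝ (subdifferential f a)) (hα : 0 ≤ α)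
    (hKL : ∃ c ν ε : ℝ, 0 < c ∧ 0 < ν ∧ 0 < ε ∧
      ∀ x ∈ M, ‖x - a‖ ≤ ε → f a < f x → f x < f a + (ν : EReal) →
        c * ((f x).toReal - (f a).toReal) ^ α ≤ ‖covariantGradient M f x‖) :
    HasKLExponentAt f a α := by
  obtain ⟨c, ν, ε, hc, hν, hε, hKL⟩ := hKL
  have h0 : 0 ∈ subdifferential f a := intrinsicInterior_subset hri
  have hproj := eventually_isNearestPoint_proj ha hM
  have hmem := eventually_fst_mem_subgradientNhds_zero ha hproj hbot hcont hprox hnormal hinner hri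
  have hgrad := eventually_norm_covariantGradient_le (hprox.2 0 h0) hbot hcont hproj hmem
  have hbasis := hasBasis_subgradientNhds (b := 0) hbot hprox.1
  refine hasKLExponentAt_of_eventually hbot h0 hα hc ?_
  filter_upwards [hmem, hgrad, hbasis.mem_of_mem hε, hbasis.mem_of_mem hν] with q hqM hq hqε hqν hlo
  exact (hKL q.1 hqM hqε.1.le hlo hqν.2.2.1).trans hq

theorem mainTheorem10 (n : ℕ) (f : EuclideanSpace ℝ (Fin n) → EReal)
    (xbar : EuclideanSpace ℝ (Fin n)) (M : Set (EuclideanSpace ℝ (Fin n)))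
    (hproper : VarAnalysis.IsProper f) (hclosed : LowerSemicontinuous f)
    (hprox : VarAnalysis.IsProxRegularAt f xbar)
    (hsmooth : VarAnalysis.IsC2PartlySmoothAt f M xbar)
    (hri : (0 : EuclideanSpace ℝ (Fin n)) ∈
      intrinsicInterior ℝ (VarAnalysis.subdifferential f xbar))
    (α : ℝ) (hα0 : 0 ≤ α) (hα1 : α < 1)
    (hKL : ∃ c ν ε : ℝ, 0 < c ∧ 0 < ν ∧ 0 < ε ∧
      ∀ x ∈ M, ‖x - xbar‖ ≤ ε → f xbar < f x → f x < f xbar + (ν : EReal) →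
        c * ((f x).toReal - (f xbar).toReal) ^ α ≤ ‖VarAnalysis.covariantGradient M f x‖) :
    VarAnalysis.HasKLExponentAt f xbar α := by
  exact mainTheorem10_general hsmooth.manifold.1 hsmooth.manifold.exists_nhds_isClosed_inter
    (hproper.1 xbar) hsmooth.continuousWithinAt hprox hsmooth.normalCone_subset_vectorSpan
    hsmooth.subgradient_continuity.lowerHemicontinuousWithinAt hri hα0 hKL
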